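/- Let $M$ be a compact complex manifold with a Kähler metric $\omega=\sqrt{-1}\,g_{\alpha\bar\beta}\,dz^\alpha\wedge d\bar z^\beta$, and let $\pi:\mathcal X\to M$ be a holomorphic fibration, i.e. a proper surjective holomorphic map from a complex manifold $\mathcal X$ whose differential has maximal rank everywhere. Let $L\to\mathcal X$ be a holomorphic line bundle. A smooth Hermitian metric on $L$ is denoted by its local weights $\phi$: $|s|^2=e^{-\phi}$ for a local holomorphic frame $s$ of $L$; the difference of two metrics $\phi-\psi$ is then a smooth function on $\mathcal X$. Let $F^+(L)$ be the set of smooth metrics $\phi$ on $L$ such that $\sqrt{-1}\partial\bar\partial\phi$ is positive on every fibre of $\pi$; it is assumed to be non-empty ($L$ is relatively ample). For $\phi\in F^+(L)$ put, in local holomorphic coordinates $(z;v)=(z^1,\dots,z^m;v^1,\dots,v^n)$ of $\mathcal X$ with $\pi(z;v)=z$, $$tr_\omega c(\phi)=g^{\alpha\bar\beta}\left(\phi_{\alpha\bar\beta}-\phi_{\alpha\bar j}\,\phi^{i\bar j}\,\phi_{i\bar\beta}\right),$$ which is a well-defined real function on $\mathcal X$. Let $\lambda\in\mathbb R$ and $\phi_0\in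 F^+(L)$. A solution of the flow on $[0,T)$, $T\le\infty$, is a family $\phi(t)$, $0\le t<T$, of metrics on $L$, smooth on $\mathcal X\times[0,T)$, such that $$\frac{\partial\phi}{\partial t}=tr_\omega c(\phi)-\lambda,\qquad \phi(t)\in F^+(L),\qquad \phi(0)=\phi_0 .$$ (1) If $\phi$ and $\psi$ are solutions of the flow with the same initial metric $\phi_0$, on $[0,T_1)$ and $[0,T_2)$ respectively, then $\phi(t)=\psi(t)$ for all $0\le t<\min(T_1,T_2)$. (2) There is a constant $C>0$, which depends on the data $(\pi,L,\omega,\lambda,\phi_0)$ but not on $T$ or on the solution, such that every solution $\phi$ on $[0,T)$ satisfies, on $\mathcal X$ and for all $0\le t<T$, $$|tr_\omega c(\phi(t))|<C\qquad\text{and}\qquad|\phi(t)-\phi_0|\le Ct .$$ -/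

import Mathlib

open scoped Manifold ContDiff

noncomputable section

namespace GeodesicFlow

/-! ### The complex Hessian -/

section Levi

variable {E : Type*} [NormedAddCommGroup E] [NormedSpace ℂ E]

/-- The complex Hessian `∑ f_{a b̄} u^a \bar{v^b}` of a real function `f` at `p`, i.e.
`(∂∂̄f)(u^{1,0}, \overline{v^{1,0}})`, written through the real second derivative of `f`.
It is `ℂ`-linear in `u` and conjugate-linear in `v`. -/
def leviForm (f : E → ℝ) (p u v : E) : ℂ :=
  let D : E → E → ℝ := fun a b => fderiv ℝ (fderiv ℝ f) p a b
  (1 / 4 : ℂ) * (((D u v + D (Complex.I • u) (Complex.I • v) : ℝ) : ℂ) +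
    Complex.I * ((D u (Complex.I • v) - D (Complex.I • u) v : ℝ) : ℂ))

end Levi

/-! ### Holomorphic fibrations -/

section Fibration

variable {E F : Type*} [NormedAddCommGroup E] [NormedSpace ℂ E]
  [NormedAddCommGroup F] [NormedSpace ℂ F]
  {X M : Type*} [TopologicalSpace X] [ChartedSpace E X] [TopologicalSpace M] [ChartedSpace F M]

/-- The (complex) differential of `π` at `x`, as a map `T_x X = E → T_{π x} M = F`; the tangent
spaces are identified with the model spaces through the preferred charts. -/
def differential (π : X → M) (x : X) : E →L[ℂ] F := mfderiv 𝓘(ℂ, E) 𝓘(ℂ, F) π x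

variable (E F) in
/-- A proper surjective holomorphic map whose differential has maximal rank everywhere. -/
structure IsHolomorphicFibration (π : X → M) : Prop where
  holomorphic : ContMDiff 𝓘(ℂ, E) 𝓘(ℂ, F) ω π
  surjective : Function.Surjective π
  proper : IsProperMap π
  submersion : ∀ x, Function.Surjective (differential (E := E) (F := F) π x)

/-- The vertical tangent space at `x`: the tangent space of the fibre through `x`. -/
def vertical (π : X → M) (x : X) : Submodule ℂ E :=
  LinearMap.ker (differential (E := E) (F := F) π x).toLinearMap

end Fibration

/-! ### Kähler metrics -/

section Kahler

variable {F : Type*} [NormedAddCommGroup F] [NormedSpace ℂ F]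
  {M : Type*} [TopologicalSpace M] [ChartedSpace F M] [IsManifold 𝓘(ℂ, F) ω M]

/-- The coefficient `g(a, \bar b)`, for constant coordinate vectors `a`, `b`, of a field of
sesquilinear forms on the tangent spaces, in the chart around `y₀`, as a function of the
coordinate `z`. -/
def localCoeff
    (g : ∀ y : M, TangentSpace 𝓘(ℂ, F) y →ₗ[ℂ] TangentSpace 𝓘(ℂ, F) y →ₗ⋆[ℂ] ℂ)
    (y₀ : M) (a b z : F) : ℂ :=
  let y : M := (chartAt F y₀).symm z
  g y (tangentCoordChange 𝓘(ℂ, F) y₀ y y a) (tangentCoordChange 𝓘(ℂ, F) y₀ y y b)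

variable (F M) in
/-- A Kähler metric `ω = √-1 g_{αβ̄} dz^α ∧ dz̄^β`: a smooth field of positive definite Hermitian
forms `g_y(a, b) = g_{αβ̄} a^α \bar{b^β}` whose fundamental form, `ω(a, b) = -2 Im g(a, b)`, is
closed. -/
structure KahlerMetric where
  form : ∀ y : M, TangentSpace 𝓘(ℂ, F) y →ₗ[ℂ] TangentSpace 𝓘(ℂ, F) y →ₗ⋆[ℂ] ℂ
  hermitian : ∀ y a b, form y b a = starRingEnd ℂ (form y a b)
  pos : ∀ y a, a ≠ 0 → 0 < (form y a a).re
  smooth : ∀ (y₀ : M) (a b : F),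
    ContDiffOn ℝ ∞ (localCoeff form y₀ a b) (chartAt F y₀).target
  closed : ∀ (y₀ : M), ∀ z ∈ (chartAt F y₀).target, ∀ a b c : F,
    fderiv ℝ (fun w => -2 * (localCoeff form y₀ b c w).im) z a
      - fderiv ℝ (fun w => -2 * (localCoeff form y₀ a c w).im) z b
      + fderiv ℝ (fun w => -2 * (localCoeff form y₀ a b w).im) z c = 0

end Kahler

/-! ### Metrics on a holomorphic line bundle -/

section LineBundle

variable {E : Type*} [NormedAddCommGroup E] [NormedSpace ℂ E]
  {X : Type*} [TopologicalSpace X] [ChartedSpace E X]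
  {L : X → Type*} [∀ x, AddCommGroup (L x)] [∀ x, Module ℂ (L x)]
  [∀ x, TopologicalSpace (L x)] [TopologicalSpace (Bundle.TotalSpace ℂ L)] [FiberBundle ℂ L]

variable (E L) in
/-- A smooth Hermitian metric on a line bundle `L`, given by the squared length of vectors.
Here `x ↦ e.symm x 1` is the local frame of `L` that belongs to the trivialization `e`. -/
@[ext]
structure LineMetric where
  normSq : ∀ x, L x → ℝ
  smul : ∀ x (c : ℂ) (v : L x), normSq x (c • v) = ‖c‖ ^ 2 * normSq x v
  pos : ∀ x (v : L x), v ≠ 0 → 0 < normSq x v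
  smooth : ∀ (e : Bundle.Trivialization ℂ (Bundle.TotalSpace.proj : Bundle.TotalSpace ℂ L → X))
    [MemTrivializationAtlas e],
    ContMDiffOn 𝓘(ℝ, E) 𝓘(ℝ, ℝ) ∞ (fun x => normSq x (e.symm x 1)) e.baseSet

/-- The local weight of a metric in the frame `s_e` of a trivialization `e`:
`|s_e|^2 = exp (-weight)`. -/
def LineMetric.weight (φ : LineMetric E L)
    (e : Bundle.Trivialization ℂ (Bundle.TotalSpace.proj : Bundle.TotalSpace ℂ L → X))
    (x : X) : ℝ :=
  -Real.log (φ.normSq x (e.symm x 1))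

/-- The global function `φ - ψ`: the difference of the local weights in a common local frame
(any local frame gives the same value). -/
def LineMetric.diff (φ ψ : LineMetric E L) (x : X) : ℝ :=
  φ.weight (trivializationAt ℂ L x) x - ψ.weight (trivializationAt ℂ L x) x

/-- The Hermitian form of `√-1 ∂∂̄φ` on the tangent space `T_x X = E`:
`(u, v) ↦ φ_{a b̄} u^a \bar{v^b}`, computed in the preferred chart at `x` from the weight of `φ` in
a local holomorphic frame. -/
def LineMetric.curvature (φ : LineMetric E L) (x : X) (u v : E) : ℂ :=
  leviForm (fun z => φ.weight (trivializationAt ℂ L x) ((chartAt E x).symm z)) (chartAt E x x) u v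

end LineBundle

/-! ### Geodesic curvature and the flow -/

section Flow

variable {E F : Type*} [NormedAddCommGroup E] [NormedSpace ℂ E] [FiniteDimensional ℂ E]
  [NormedAddCommGroup F] [NormedSpace ℂ F] [FiniteDimensional ℂ F]
  {X M : Type*} [TopologicalSpace X] [ChartedSpace E X] [TopologicalSpace M] [ChartedSpace F M]
  {L : X → Type*} [∀ x, AddCommGroup (L x)] [∀ x, Module ℂ (L x)]
  [∀ x, TopologicalSpace (L x)] [TopologicalSpace (Bundle.TotalSpace ℂ L)] [FiberBundle ℂ L]

/-- `F⁺(L)`: the smooth metrics `φ` on `L` such that `√-1 ∂∂̄φ` is positive on every fibre. -/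
def FPlus (π : X → M) : Set (LineMetric E L) :=
  {φ | ∀ x, ∀ v ∈ vertical (E := E) (F := F) π x, v ≠ 0 → 0 < (φ.curvature x v v).re}

/-- The geodesic curvature `c(φ)`, a Hermitian form on `T_x X = E`:
`c(φ)(u, w) = φ(u, w̄) - φ(u, v̄_j) φ^{i j̄} φ(v_i, w̄)`, where `(v_i)` is a basis of the vertical
space and `φ^{i j̄}` is the inverse of `φ_{i j̄} = φ(v_i, v̄_j)`, i.e. `φ_{k j̄} φ^{i j̄} = δ_{ki}`.
(It does not depend on the basis and vanishes when `u` or `w` is vertical, so that in admissible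
coordinates `(z; v)` it is `(φ_{αβ̄} - φ_{αj̄} φ^{ij̄} φ_{iβ̄}) dz^α ⊗ dz̄^β`.) -/
def geodesicCurvature (π : X → M) (φ : LineMetric E L) (x : X) (u w : E) : ℂ :=
  let v := Module.finBasis ℂ (vertical (E := E) (F := F) π x)
  let D : Matrix _ _ ℂ := Matrix.of fun k j => φ.curvature x (v k : E) (v j : E)
  φ.curvature x u w -
    ∑ i, ∑ j, φ.curvature x u (v j : E) * D⁻¹ j i * φ.curvature x (v i : E) w

variable [IsManifold 𝓘(ℂ, F) ω M]

/-- `tr_ω c(φ) = g^{αβ̄} c(φ)_{αβ̄}`: here `(e_α)` is a basis of `T_{π x} M = F`,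
`g_{αβ̄} = g(e_α, ē_β)`, `g^{αβ̄}` is the inverse matrix (`g_{γβ̄} g^{αβ̄} = δ_{γα}`), and
`c(φ)_{αβ̄}` is the value of `c(φ)` on lifts of `e_α`, `e_β` to `T_x X` (any lifts give the same
value, because `c(φ)` vanishes on vertical vectors). -/
def trGeodesicCurvature (π : X → M) (g : KahlerMetric F M) (φ : LineMetric E L) (x : X) : ℝ :=
  let e := Module.finBasis ℂ F
  let lift : Fin (Module.finrank ℂ F) → E := fun α =>
    Function.invFun (differential (E := E) (F := F) π x) (e α)
  let G : Matrix _ _ ℂ := Matrix.of fun α β => g.form (π x) (e α) (e β)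
  let c : Matrix _ _ ℂ := Matrix.of fun α β =>
    geodesicCurvature (F := F) π φ x (lift α) (lift β)
  (∑ α, ∑ β, G⁻¹ β α * c α β).re

/-- The interval `[0, T)`, where `T ≤ ∞`. -/
def timeInterval (T : EReal) : Set ℝ := {t | 0 ≤ t ∧ (t : EReal) < T}

/-- `φ` is a (smooth) solution on `X × [0, T)` of the flow `∂φ/∂t = tr_ω c(φ) - lam`, `φ ∈ F⁺(L)`,
`φ(0) = φ₀`. The values of `φ` at times outside `[0, T)` play no role. -/
structure IsFlowSolution (π : X → M) (g : KahlerMetric F M) (lam : ℝ) (φ₀ : LineMetric E L)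
    (T : EReal) (φ : ℝ → LineMetric E L) : Prop where
  smooth : ∀ (e : Bundle.Trivialization ℂ
      (Bundle.TotalSpace.proj : Bundle.TotalSpace ℂ L → X)) [MemTrivializationAtlas e],
    ContMDiffOn (𝓘(ℝ, E).prod 𝓘(ℝ, ℝ)) 𝓘(ℝ, ℝ) ∞
      (fun p : X × ℝ => (φ p.2).weight e p.1) (e.baseSet ×ˢ timeInterval T)
  mem_FPlus : ∀ t ∈ timeInterval T, φ t ∈ FPlus (F := F) π
  equation : ∀ t ∈ timeInterval T, ∀ x : X,
    HasDerivWithinAt (fun s => (φ s).weight (trivializationAt ℂ L x) x)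
      (trGeodesicCurvature π g (φ t) x - lam) (timeInterval T) t
  initial : φ 0 = φ₀

end Flow

end GeodesicFlow

end

/-! The operator `φ ↦ tr_ω c(φ)` is monotone at contact points, so the flow obeys a comparison
principle although it is degenerate parabolic. At a spatial maximum of `φ - ψ` the complex Hessian
of `φ` is at most that of `ψ` (`LineMetric.curvature_le_of_isMax`). The geodesic curvature is the
Schur complement of this Hessian along the vertical space, that is, its minimum over all lifts of a
base direction. As a minimum it is monotone in the form (`schur_mono`), and the trace against the
positive matrix `g⁻¹` keeps the inequality (`trGeodesicCurvature_le_of_isMax`). With the parabolic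
maximum principle on the compact space `X` this becomes `IsEvolution.diff_le`.

The theorem follows from three choices of the pair to compare. Two solutions give uniqueness. A
solution and the constant family `φ₀` give `|φ(t) - φ₀| ≤ K t`, where `K` bounds `|tr_ω c(φ₀) -
lam|`. A solution and its own time shift give `|φ(s) - φ(t)| ≤ K (s - t)`, hence speed at most `K`
at all times.

The finiteness of `K` is read off from any one solution: smoothness up to `t = 0` makes it locally
Lipschitz in time, its time derivative at `0` is `tr_ω c(φ₀) - lam`, and `X` is compact. -/

noncomputable section

namespace GeodesicFlow

/-! ### Hermitian linear algebra: Schur complements and their monotonicity. -/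

section Algebra

open Matrix ComplexOrder

variable {E : Type*} [AddCommGroup E] [Module ℂ E] {ι : Type*} [Fintype ι]

/-- The Gram matrix of a family of vectors with respect to a sesquilinear form. -/
def gram (B : E →ₗ[ℂ] E →ₗ⋆[ℂ] ℂ) (v : ι → E) : Matrix ι ι ℂ := Matrix.of fun i j => B (v i) (v j)

/-- The form is linear in its first slot, where the quadratic form carries `star x`; this is why the
coefficients are conjugated. -/
theorem star_dotProduct_gram_mulVec (B : E →ₗ[ℂ] E →ₗ⋆[ℂ] ℂ) (v : ι → E) (x : ι → ℂ) :
    star x ⬝ᵥ (gram B v *ᵥ x) = B (∑ i, star (x i) • v i) (∑ i, star (x i) • v i) := by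
  simp [dotProduct, mulVec, gram, map_sum, Finset.mul_sum, LinearMap.sum_apply]
  rw [Finset.sum_comm]
  refine Finset.sum_congr rfl fun i _ => Finset.sum_congr rfl fun j _ => by ring

theorem gram_isHermitian {ι : Type*} {B : E →ₗ[ℂ] E →ₗ⋆[ℂ] ℂ}
    (hB : ∀ a b, B b a = starRingEnd ℂ (B a b))
    (v : ι → E) : (gram B v).IsHermitian := by
  ext i j
  simp [gram, hB (v i) (v j)]

theorem apply_self_eq_re {B : E →ₗ[ℂ] E →ₗ⋆[ℂ] ℂ} (hB : ∀ a b, B b a = starRingEnd ℂ (B a b))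
    (u : E) : B u u = ((B u u).re : ℂ) :=
  (Complex.conj_eq_iff_re.mp (hB u u).symm).symm

theorem gram_posDef {B : E →ₗ[ℂ] E →ₗ⋆[ℂ] ℂ} (hB : ∀ a b, B b a = starRingEnd ℂ (B a b))
    {v : ι → E} (hv : LinearIndependent ℂ v)
    (hpos : ∀ u ∈ Submodule.span ℂ (Set.range v), u ≠ 0 → 0 < (B u u).re) :
    (gram B v).PosDef := by
  refine Matrix.PosDef.of_dotProduct_mulVec_pos (gram_isHermitian hB v) fun x hx => ?_
  rw [star_dotProduct_gram_mulVec, apply_self_eq_re hB]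
  have := hpos (∑ i, star (x i) • v i)
    (Submodule.sum_mem _ fun i _ => Submodule.smul_mem _ _ (Submodule.subset_span ⟨i, rfl⟩))
    fun h => hx (by
      ext i
      simpa using Fintype.linearIndependent_iff.mp hv (fun i => star (x i)) h i)
  exact_mod_cast this

theorem gram_posSemidef {B : E →ₗ[ℂ] E →ₗ⋆[ℂ] ℂ} (hB : ∀ a b, B b a = starRingEnd ℂ (B a b))
    (v : ι → E) (hpos : ∀ u, 0 ≤ (B u u).re) : (gram B v).PosSemidef := by
  refine Matrix.PosSemidef.of_dotProduct_mulVec_nonneg (gram_isHermitian hB v) fun x => ?_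
  rw [star_dotProduct_gram_mulVec, apply_self_eq_re hB]
  exact_mod_cast hpos _

/-- Writing `A = S* S`, the trace is that of `S C S*`, which is positive semidefinite. -/
theorem trace_mul_nonneg_of_posSemidef [DecidableEq ι] {A C : Matrix ι ι ℂ} (hA : A.PosSemidef)
    (hC : C.PosSemidef) : 0 ≤ (A * C).trace := by
  open scoped MatrixOrder in
  obtain ⟨S, rfl⟩ := CStarAlgebra.nonneg_iff_eq_star_mul_self.mp hA.nonneg
  rw [Matrix.mul_assoc, Matrix.trace_mul_comm]
  exact (hC.mul_mul_conjTranspose_same S).trace_nonneg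

variable [DecidableEq ι]

/-- The vector `u - ∑ a_i v_i` which is orthogonal to the family `v`, provided that the Gram matrix
of `v` is invertible. -/
def projOrth (B : E →ₗ[ℂ] E →ₗ⋆[ℂ] ℂ) (v : ι → E) : E →ₗ[ℂ] E :=
  LinearMap.id - ∑ i, (∑ j, (gram B v)⁻¹ j i • B.flip (v j)).smulRight (v i)

theorem projOrth_apply (B : E →ₗ[ℂ] E →ₗ⋆[ℂ] ℂ) (v : ι → E) (u : E) :
    projOrth B v u = u - ∑ i, (∑ j, B u (v j) * (gram B v)⁻¹ j i) • v i := by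
  simp [projOrth, LinearMap.sum_apply, mul_comm]

theorem apply_projOrth (B : E →ₗ[ℂ] E →ₗ⋆[ℂ] ℂ) (v : ι → E) (u w : E) :
    B (projOrth B v u) w =
      B u w - ∑ i, ∑ j, B u (v j) * (gram B v)⁻¹ j i * B (v i) w := by
  simp [projOrth_apply, LinearMap.sum_apply, Finset.sum_mul]

theorem apply_projOrth_basis {B : E →ₗ[ℂ] E →ₗ⋆[ℂ] ℂ} {v : ι → E} (h : IsUnit (gram B v).det)
    (u : E) (k : ι) : B (projOrth B v u) (v k) = 0 := by
  rw [apply_projOrth, Finset.sum_comm, sub_eq_zero]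
  have : ∀ j, ∑ i, B u (v j) * (gram B v)⁻¹ j i * B (v i) (v k)
      = B u (v j) * (1 : Matrix ι ι ℂ) j k := fun j => by
    rw [← Matrix.nonsing_inv_mul _ h, Matrix.mul_apply, Finset.mul_sum]
    exact Finset.sum_congr rfl fun i _ => by simp [gram, mul_assoc]
  simp [this, Matrix.one_apply]

theorem apply_projOrth_of_mem_span {B : E →ₗ[ℂ] E →ₗ⋆[ℂ] ℂ} {v : ι → E}
    (h : IsUnit (gram B v).det) (u : E) {w : E} (hw : w ∈ Submodule.span ℂ (Set.range v)) :
    B (projOrth B v u) w = 0 := by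
  have : Submodule.span ℂ (Set.range v) ≤ LinearMap.ker (B (projOrth B v u)) := by
    rw [Submodule.span_le]
    rintro _ ⟨k, rfl⟩
    exact apply_projOrth_basis h u k
  exact this hw

theorem sub_projOrth_mem_span (B : E →ₗ[ℂ] E →ₗ⋆[ℂ] ℂ) (v : ι → E) (u : E) :
    u - projOrth B v u ∈ Submodule.span ℂ (Set.range v) := by
  rw [projOrth_apply, sub_sub_cancel]
  exact Submodule.sum_mem _ fun i _ => Submodule.smul_mem _ _ (Submodule.subset_span ⟨i, rfl⟩)

/-- The Schur complement of a Hermitian form with respect to a family of vectors. -/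
def schur (B : E →ₗ[ℂ] E →ₗ⋆[ℂ] ℂ) (v : ι → E) : E →ₗ[ℂ] E →ₗ⋆[ℂ] ℂ :=
  B ∘ₗ projOrth B v

theorem schur_apply (B : E →ₗ[ℂ] E →ₗ⋆[ℂ] ℂ) (v : ι → E) (u w : E) :
    schur B v u w =
      B u w - ∑ i, ∑ j, B u (v j) * (gram B v)⁻¹ j i * B (v i) w :=
  apply_projOrth B v u w

theorem schur_eq {B : E →ₗ[ℂ] E →ₗ⋆[ℂ] ℂ} {v : ι → E} (h : IsUnit (gram B v).det) (u w : E) :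
    schur B v u w = B (projOrth B v u) (projOrth B v w) := by
  have := apply_projOrth_of_mem_span h u (sub_projOrth_mem_span B v w)
  rw [map_sub, sub_eq_zero] at this
  exact this

theorem schur_hermitian {B : E →ₗ[ℂ] E →ₗ⋆[ℂ] ℂ} (hB : ∀ a b, B b a = starRingEnd ℂ (B a b))
    {v : ι → E} (h : IsUnit (gram B v).det) (a b : E) :
    schur B v b a = starRingEnd ℂ (schur B v a b) := by
  rw [schur_eq h, schur_eq h, hB]

/-- The Schur complement at `u` is the minimum of the form over the translates of `u` by the span
of the family. -/
theorem schur_self_le {B : E →ₗ[ℂ] E →ₗ⋆[ℂ] ℂ} (hB : ∀ a b, B b a = starRingEnd ℂ (B a b))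
    {v : ι → E} (hv : LinearIndependent ℂ v)
    (hpos : ∀ u ∈ Submodule.span ℂ (Set.range v), u ≠ 0 → 0 < (B u u).re)
    {u w : E} (hw : u - w ∈ Submodule.span ℂ (Set.range v)) :
    (schur B v u u).re ≤ (B w w).re := by
  have hu : IsUnit (gram B v).det := (Matrix.isUnit_iff_isUnit_det _).mp (gram_posDef hB hv hpos).isUnit
  set p := projOrth B v u
  have hd : w - p ∈ Submodule.span ℂ (Set.range v) := by
    have := Submodule.sub_mem _ (sub_projOrth_mem_span B v u) hw
    rwa [sub_sub_sub_cancel_left] at this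
  have h1 : B p (w - p) = 0 := apply_projOrth_of_mem_span hu u hd
  have h2 : B (w - p) p = 0 := by rw [hB p, h1, map_zero]
  -- Pythagoras: `w - p` lies in the span, to which `p` is orthogonal.
  have h3 : B w w = B p p + B (w - p) (w - p) := by
    have : w = p + (w - p) := by abel
    conv_lhs => rw [this]
    simp only [map_add, LinearMap.add_apply, h1, h2]
    ring
  rw [schur_eq hu, h3, Complex.add_re]
  have : 0 ≤ (B (w - p) (w - p)).re := by
    rcases eq_or_ne (w - p) 0 with h | h
    · simp [h]
    · exact (hpos _ hd h).le
  linarith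

/-- The minimizer for `C` is a competitor in the minimum problem for `B`. -/
theorem schur_mono {B C : E →ₗ[ℂ] E →ₗ⋆[ℂ] ℂ} (hB : ∀ a b, B b a = starRingEnd ℂ (B a b))
    (hC : ∀ a b, C b a = starRingEnd ℂ (C a b)) {v : ι → E} (hv : LinearIndependent ℂ v)
    (hBpos : ∀ u ∈ Submodule.span ℂ (Set.range v), u ≠ 0 → 0 < (B u u).re)
    (hCpos : ∀ u ∈ Submodule.span ℂ (Set.range v), u ≠ 0 → 0 < (C u u).re)
    (hBC : ∀ u, (B u u).re ≤ (C u u).re) (u : E) :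
    (schur B v u u).re ≤ (schur C v u u).re := by
  have hu : IsUnit (gram C v).det := (Matrix.isUnit_iff_isUnit_det _).mp (gram_posDef hC hv hCpos).isUnit
  rw [schur_eq hu]
  exact (schur_self_le hB hv hBpos (sub_projOrth_mem_span C v u)).trans (hBC _)

theorem trace_inv_mul_schur_mono {κ : Type*} [Fintype κ] [DecidableEq κ]
    {B C : E →ₗ[ℂ] E →ₗ⋆[ℂ] ℂ} (hB : ∀ a b, B b a = starRingEnd ℂ (B a b))
    (hC : ∀ a b, C b a = starRingEnd ℂ (C a b)) {v : ι → E} (hv : LinearIndependent ℂ v)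
    (hBpos : ∀ u ∈ Submodule.span ℂ (Set.range v), u ≠ 0 → 0 < (B u u).re)
    (hCpos : ∀ u ∈ Submodule.span ℂ (Set.range v), u ≠ 0 → 0 < (C u u).re)
    (hBC : ∀ u, (B u u).re ≤ (C u u).re) {G : Matrix κ κ ℂ} (hG : G.PosDef) (l : κ → E) :
    (G⁻¹ * gram (schur B v) l).trace.re ≤ (G⁻¹ * gram (schur C v) l).trace.re := by
  have huB := (Matrix.isUnit_iff_isUnit_det _).mp (gram_posDef hB hv hBpos).isUnit
  have huC := (Matrix.isUnit_iff_isUnit_det _).mp (gram_posDef hC hv hCpos).isUnit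
  have hgram : gram (schur C v - schur B v) l = gram (schur C v) l - gram (schur B v) l := by
    ext i j
    simp [gram]
  have hpsd : (gram (schur C v - schur B v) l).PosSemidef := by
    refine gram_posSemidef (fun a b => ?_) l fun u => ?_
    · simp [schur_hermitian hB huB a b, schur_hermitian hC huC a b]
    · simpa using schur_mono hB hC hv hBpos hCpos hBC u
  have := (Complex.le_def.mp (trace_mul_nonneg_of_posSemidef hG.inv.posSemidef hpsd)).1
  rw [hgram, Matrix.mul_sub, Matrix.trace_sub] at this
  simpa using this

end Algebra

/-! ### Sesquilinearity and Hermitian symmetry of the complex Hessian. -/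

section LeviForm

open Filter Topology

variable {E : Type*} [NormedAddCommGroup E] [NormedSpace ℂ E]

/-- `leviForm f p` as a sesquilinear map. -/
def leviMap (f : E → ℝ) (p : E) : E →ₗ[ℂ] E →ₗ⋆[ℂ] ℂ :=
  have smul_real (c : ℂ) (u : E) : c • u = c.re • u + c.im • (Complex.I • u) := by
    rw [← Complex.coe_smul, ← Complex.coe_smul, smul_smul, ← add_smul, Complex.re_add_im]
  have I_smul_I (u : E) : Complex.I • Complex.I • u = -u := by
    rw [smul_smul, Complex.I_mul_I, neg_one_smul]
  LinearMap.mk₂'ₛₗ (RingHom.id ℂ) (starRingEnd ℂ) (leviForm f p)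
    (fun u u' v => by
      simp only [leviForm, smul_add, map_add, add_apply]
      push_cast
      ring)
    (fun c u v => by
      simp only [leviForm, smul_real c u, smul_add, smul_comm Complex.I (_ : ℝ) (_ : E), I_smul_I,
        map_add, map_smul, map_neg, add_apply, smul_apply,
        neg_apply, smul_eq_mul, RingHom.id_apply]
      push_cast
      conv_rhs => rw [← Complex.re_add_im c]
      ring_nf
      simp only [Complex.I_sq]
      ring)
    (fun u v v' => by
      simp only [leviForm, smul_add, map_add]
      push_cast
      ring)
    (fun c u v => by
      simp only [leviForm, smul_real c v, smul_add, smul_comm Complex.I (_ : ℝ) (_ : E), I_smul_I,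
        map_add, map_smul, map_neg, smul_eq_mul]
      push_cast
      have : starRingEnd ℂ c = c.re - c.im * Complex.I := by
        apply Complex.ext <;> simp
      rw [this]
      ring_nf
      simp only [Complex.I_sq]
      ring)

theorem leviForm_hermitian {f : E → ℝ} {p : E} (hf : ContDiffAt ℝ 2 f p) (u v : E) :
    leviForm f p v u = starRingEnd ℂ (leviForm f p u v) := by
  have hs : ∀ a b, fderiv ℝ (fderiv ℝ f) p a b = fderiv ℝ (fderiv ℝ f) p b a :=
    hf.isSymmSndFDerivAt (by simp)
  simp only [leviForm, hs v, hs (Complex.I • v)]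
  apply Complex.ext <;> simp

theorem leviForm_self_re (f : E → ℝ) (p u : E) :
    (leviForm f p u u).re = (1 / 4) * (fderiv ℝ (fderiv ℝ f) p u u +
      fderiv ℝ (fderiv ℝ f) p (Complex.I • u) (Complex.I • u)) := by
  simp [leviForm]

end LeviForm

/-! ### The second derivative test at a local maximum. -/

section SecondDerivative

open Filter Topology

/-- A positive second derivative would make `a` a local minimum too, so `f` would be locally
constant and the second derivative zero. -/
theorem _root_.IsLocalMax.deriv_deriv_nonpos {f : ℝ → ℝ} {a : ℝ} (h : IsLocalMax f a)
    (hc : ContinuousAt f a) : deriv (deriv f) a ≤ 0 := by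
  by_contra! hpos
  have hmin := isLocalMin_of_deriv_deriv_pos hpos h.deriv_eq_zero hc
  have heq : f =ᶠ[𝓝 a] fun _ => f a := by
    filter_upwards [h, hmin] with x h1 h2 using le_antisymm h1 h2
  have := heq.deriv.deriv_eq
  simp [this] at hpos

variable {E : Type*} [NormedAddCommGroup E] [NormedSpace ℝ E]

theorem _root_.IsLocalMax.fderiv_fderiv_nonpos {f : E → ℝ} {p : E} (h : IsLocalMax f p)
    (hf : ContDiffAt ℝ 2 f p) (u : E) : fderiv ℝ (fderiv ℝ f) p u u ≤ 0 := by
  have hl : ∀ t : ℝ, HasDerivAt (fun s : ℝ => p + s • u) u t := fun t => by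
    simpa using ((hasDerivAt_id t).smul_const u).const_add p
  have hlc : Tendsto (fun s : ℝ => p + s • u) (𝓝 0) (𝓝 p) := by
    simpa using (hl 0).continuousAt.tendsto
  have hdiff : ∀ᶠ z in 𝓝 p, DifferentiableAt ℝ f z :=
    (hf.eventually (by simp)).mono fun z hz => hz.differentiableAt (by simp)
  have hmax : IsLocalMax (fun s : ℝ => f (p + s • u)) 0 := by
    have := hlc.eventually h
    simpa [IsLocalMax, IsMaxFilter] using this
  have hderiv : deriv (fun s : ℝ => f (p + s • u)) =ᶠ[𝓝 0]
      fun s => fderiv ℝ f (p + s • u) u := by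
    filter_upwards [hlc.eventually hdiff] with s hs
    exact (hs.hasFDerivAt.comp_hasDerivAt s (hl s)).deriv
  have h2 : DifferentiableAt ℝ (fderiv ℝ f) p :=
    (hf.fderiv_right (m := 1) (by norm_num)).differentiableAt (by simp)
  have h3 : HasDerivAt (fun s : ℝ => fderiv ℝ f (p + s • u) u) (fderiv ℝ (fderiv ℝ f) p u u) 0 := by
    have h2' : HasFDerivAt (fderiv ℝ f) (fderiv ℝ (fderiv ℝ f) p) (p + (0 : ℝ) • u) := by
      simpa using h2.hasFDerivAt
    exact (ContinuousLinearMap.apply ℝ ℝ u).hasFDerivAt.comp_hasDerivAt (0 : ℝ)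
      (h2'.comp_hasDerivAt (0 : ℝ) (hl 0))
  have := hmax.deriv_deriv_nonpos
    (ContinuousAt.comp (f := fun s : ℝ => p + s • u) (by simpa using hf.continuousAt)
      (hl 0).continuousAt)
  rwa [hderiv.deriv_eq, h3.deriv] at this

end SecondDerivative

/-! ### Comparison of complex Hessians at a maximum of the difference. -/

section LeviMax

open Filter Topology

variable {E : Type*} [NormedAddCommGroup E] [NormedSpace ℂ E]

theorem leviForm_self_re_le_of_isLocalMax {f g : E → ℝ} {p : E} (hf : ContDiffAt ℝ 2 f p)
    (hg : ContDiffAt ℝ 2 g p) (h : IsLocalMax (fun z => f z - g z) p) (u : E) :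
    (leviForm f p u u).re ≤ (leviForm g p u u).re := by
  have hdf : ∀ {k : E → ℝ}, ContDiffAt ℝ 2 k p → DifferentiableAt ℝ (fderiv ℝ k) p := fun hk =>
    (hk.fderiv_right (m := 1) (by norm_num)).differentiableAt (by simp)
  have hev : fderiv ℝ (fun z => f z - g z) =ᶠ[𝓝 p] fun z => fderiv ℝ f z - fderiv ℝ g z := by
    filter_upwards [hf.eventually (by simp), hg.eventually (by simp)] with z h1 h2
    exact fderiv_fun_sub (h1.differentiableAt (by simp)) (h2.differentiableAt (by simp))
  have key : ∀ w, fderiv ℝ (fderiv ℝ f) p w w ≤ fderiv ℝ (fderiv ℝ g) p w w := fun w => by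
    have := h.fderiv_fderiv_nonpos (hf.sub hg) w
    rw [hev.fderiv_eq, fderiv_fun_sub (hdf hf) (hdf hg)] at this
    simpa using this
  rw [leviForm_self_re, leviForm_self_re]
  -- On the diagonal the Levi form averages the real Hessian over the directions `u` and `I • u`.
  linarith [key u, key (Complex.I • u)]

end LeviMax

/-! ### The parabolic maximum principle and one-sided difference quotients. -/

section MaximumPrinciple

open Filter Topology Set

theorem exists_mem_Ico_lt_of_hasDerivWithinAt_neg {f : ℝ → ℝ} {f' a b : ℝ} (hab : a < b)
    (hf : HasDerivWithinAt f f' (Icc a b) b) (hf' : f' < 0) : ∃ s ∈ Ico a b, f b < f s := by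
  have h1 : Tendsto (slope f b) (𝓝[Ico a b] b) (𝓝 f') := by
    have := hasDerivWithinAt_iff_tendsto_slope.mp hf
    rwa [Icc_sdiff_right] at this
  have : (𝓝[Ico a b] b).NeBot := by
    rw [← mem_closure_iff_nhdsWithin_neBot, closure_Ico hab.ne]
    exact right_mem_Icc.mpr hab.le
  obtain ⟨s, hs, hsI⟩ := ((h1.eventually (gt_mem_nhds hf')).and self_mem_nhdsWithin).exists
  refine ⟨s, hsI, ?_⟩
  rw [slope_def_field, div_neg_iff] at hs
  rcases hs with h | h
  · linarith [h.1]
  · linarith [h.2, hsI.2]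

/-- The parabolic maximum principle on a compact space: if the time derivative of `f` is at most `K`
at all spatial maxima, then the maximum of `f` grows at most at rate `K`. -/
theorem le_add_mul_of_deriv_le_at_max {X : Type*} [TopologicalSpace X] [CompactSpace X]
    {f f' : X → ℝ → ℝ} {a m K : ℝ}
    (hcont : ContinuousOn (fun p : X × ℝ => f p.1 p.2) (univ ×ˢ Icc 0 a))
    (hderiv : ∀ x, ∀ t ∈ Icc 0 a, HasDerivWithinAt (f x) (f' x t) (Icc 0 a) t)
    (hinit : ∀ x, f x 0 ≤ m)
    (hmax : ∀ t ∈ Icc 0 a, ∀ x, (∀ y, f y t ≤ f x t) → f' x t ≤ K) :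
    ∀ x, ∀ t ∈ Icc 0 a, f x t ≤ m + K * t := by
  intro x t ht
  refine le_of_forall_pos_le_add fun ε hε => ?_
  -- The extra slope `δ` makes the derivative at the maximum strictly negative, at a cost of at most
  -- `ε` at time `t`.
  obtain ⟨δ, hδ, hδt⟩ : ∃ δ > 0, δ * t ≤ ε := by
    refine ⟨ε / (t + 1), by have := ht.1; positivity, ?_⟩
    have := ht.1
    rw [div_mul_eq_mul_div, div_le_iff₀ (by linarith)]
    nlinarith
  obtain ⟨⟨x₀, t₀⟩, ⟨-, ht₀⟩, h₀⟩ := (isCompact_univ.prod isCompact_Icc).exists_isMaxOn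
    (f := fun p : X × ℝ => f p.1 p.2 - (K + δ) * p.2) ⟨(x, t), mem_univ _, ht⟩
    (hcont.sub (by fun_prop))
  have h₀' : ∀ y, ∀ s ∈ Icc 0 a, f y s - (K + δ) * s ≤ f x₀ t₀ - (K + δ) * t₀ :=
    fun y s hs => h₀ (show (y, s) ∈ univ ×ˢ Icc 0 a from ⟨mem_univ _, hs⟩)
  rcases ht₀.1.eq_or_lt with h | hpos
  · have h1 := h₀' x t ht
    have h2 := hinit x₀
    simp only at h
    rw [← h] at h1
    linarith
  · exfalso
    have hd : f' x₀ t₀ ≤ K := hmax t₀ ht₀ x₀ fun y => by linarith [h₀' y t₀ ht₀]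
    -- Only times before `t₀` are used, since `t₀` may be the endpoint `a`.
    have h1 : HasDerivWithinAt (fun s => f x₀ s - (K + δ) * s) (f' x₀ t₀ - (K + δ)) (Icc 0 t₀) t₀ := by
      have := (hasDerivWithinAt_id t₀ (Icc 0 t₀)).const_mul (K + δ)
      simpa using ((hderiv x₀ t₀ ht₀).mono (Icc_subset_Icc_right ht₀.2)).fun_sub this
    obtain ⟨s, hs, hlt⟩ := exists_mem_Ico_lt_of_hasDerivWithinAt_neg hpos h1 (by linarith)
    exact absurd (h₀' x₀ s ⟨hs.1, hs.2.le.trans ht₀.2⟩) (not_le.mpr hlt)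

theorem abs_le_of_hasDerivWithinAt_of_lipschitz {f : ℝ → ℝ} {f' a b C : ℝ} {s : Set ℝ} (hab : a < b)
    (hs : Icc a b ⊆ s) (hf : HasDerivWithinAt f f' s a)
    (hC : ∀ t ∈ Icc a b, |f t - f a| ≤ C * (t - a)) : |f'| ≤ C := by
  have h1 : Tendsto (slope f a) (𝓝[Ioc a b] a) (𝓝 f') := by
    have := hasDerivWithinAt_iff_tendsto_slope.mp (hf.mono hs)
    rwa [Icc_sdiff_left] at this
  have : (𝓝[Ioc a b] a).NeBot := by
    rw [← mem_closure_iff_nhdsWithin_neBot, closure_Ioc hab.ne]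
    exact left_mem_Icc.mpr hab.le
  refine le_of_tendsto h1.abs ?_
  filter_upwards [self_mem_nhdsWithin] with t ht
  rw [slope_def_field, abs_div, abs_of_pos (sub_pos.mpr ht.1), div_le_iff₀ (sub_pos.mpr ht.1)]
  exact hC t ⟨ht.1.le, ht.2⟩

end MaximumPrinciple

/-! ### Differences of metrics, independent of the frame. -/

section LineMetric

open Filter Topology

variable {E : Type*} [NormedAddCommGroup E] [NormedSpace ℂ E]
  {X : Type*} [TopologicalSpace X] [ChartedSpace E X]
  {L : X → Type*} [∀ x, AddCommGroup (L x)] [∀ x, Module ℂ (L x)]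
  [TopologicalSpace (Bundle.TotalSpace ℂ L)]

theorem exists_eq_smul_frame {x : X}
    (e : Bundle.Trivialization ℂ (Bundle.TotalSpace.proj : Bundle.TotalSpace ℂ L → X))
    [e.IsLinear ℂ] (hx : x ∈ e.baseSet) (v : L x) : ∃ c : ℂ, v = c • e.symm x 1 := by
  refine ⟨e.linearMapAt ℂ x v, ?_⟩
  rw [← e.symmₗ_apply (R := ℂ) hx, ← map_smul, smul_eq_mul, mul_one, e.symmₗ_linearMapAt hx]

theorem frame_ne_zero {x : X}
    (e : Bundle.Trivialization ℂ (Bundle.TotalSpace.proj : Bundle.TotalSpace ℂ L → X))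
    [e.IsLinear ℂ] (hx : x ∈ e.baseSet) : e.symm x 1 ≠ 0 := by
  intro h
  have := e.linearMapAt_symmₗ (R := ℂ) hx 1
  rw [e.symmₗ_apply (R := ℂ) hx, h, map_zero] at this
  exact zero_ne_one this

variable [∀ x, TopologicalSpace (L x)] [FiberBundle ℂ L] [VectorBundle ℂ ℂ L]

/-- A change of frame by the factor `c` shifts both weights by the same `-log ‖c‖²`. -/
theorem LineMetric.weight_sub_weight (φ ψ : LineMetric E L) {x : X}
    (e e' : Bundle.Trivialization ℂ (Bundle.TotalSpace.proj : Bundle.TotalSpace ℂ L → X))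
    [MemTrivializationAtlas e] [MemTrivializationAtlas e'] (hx : x ∈ e.baseSet)
    (hx' : x ∈ e'.baseSet) :
    φ.weight e x - ψ.weight e x = φ.weight e' x - ψ.weight e' x := by
  obtain ⟨c, hc⟩ := exists_eq_smul_frame e' hx' (e.symm x 1)
  have h0 := frame_ne_zero e' hx'
  have hc0 : ‖c‖ ^ 2 ≠ 0 := by
    have : c ≠ 0 := by
      rintro rfl
      exact frame_ne_zero e hx (by rw [hc, zero_smul])
    simpa using this
  rw [LineMetric.weight, LineMetric.weight, hc, φ.smul, ψ.smul,
    Real.log_mul hc0 (φ.pos _ _ h0).ne', Real.log_mul hc0 (ψ.pos _ _ h0).ne']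
  simp only [LineMetric.weight]
  ring

theorem LineMetric.diff_eq (φ ψ : LineMetric E L) {x : X}
    (e : Bundle.Trivialization ℂ (Bundle.TotalSpace.proj : Bundle.TotalSpace ℂ L → X))
    [MemTrivializationAtlas e] (hx : x ∈ e.baseSet) :
    φ.diff ψ x = φ.weight e x - ψ.weight e x :=
  φ.weight_sub_weight ψ _ e (FiberBundle.mem_baseSet_trivializationAt' x) hx

theorem LineMetric.eq_of_diff_eq_zero {φ ψ : LineMetric E L} (h : ∀ x, φ.diff ψ x = 0) :
    φ = ψ := by
  ext x v
  have hx := FiberBundle.mem_baseSet_trivializationAt' (F := ℂ) (E := L) x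
  have h0 := frame_ne_zero (trivializationAt ℂ L x) hx
  obtain ⟨c, rfl⟩ := exists_eq_smul_frame (trivializationAt ℂ L x) hx v
  rw [φ.smul, ψ.smul]
  have := h x
  rw [LineMetric.diff, LineMetric.weight, LineMetric.weight, neg_sub_neg, sub_eq_zero] at this
  rw [Real.log_injOn_pos (ψ.pos _ _ h0) (φ.pos _ _ h0) this]

theorem LineMetric.contDiffAt_weight (φ : LineMetric E L) (x : X) :
    ContDiffAt ℝ 2 (fun z => φ.weight (trivializationAt ℂ L x) ((chartAt E x).symm z))
      (chartAt E x x) := by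
  have hx := FiberBundle.mem_baseSet_trivializationAt' (F := ℂ) (E := L) x
  have h1 := (φ.smooth (trivializationAt ℂ L x)).contMDiffAt
    ((trivializationAt ℂ L x).open_baseSet.mem_nhds hx)
  have h2 : ContDiffWithinAt ℝ ∞ (fun z => φ.normSq ((chartAt E x).symm z)
      ((trivializationAt ℂ L x).symm ((chartAt E x).symm z) 1)) (Set.range 𝓘(ℝ, E))
      (chartAt E x x) := (contMDiffAt_iff.mp h1).2
  rw [modelWithCornersSelf_coe, Set.range_id, contDiffWithinAt_univ] at h2
  have hne : ∀ y ∈ (trivializationAt ℂ L x).baseSet,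
      φ.normSq y ((trivializationAt ℂ L x).symm y 1) ≠ 0 := fun y hy =>
    (φ.pos _ _ (frame_ne_zero _ hy)).ne'
  refine ((h2.of_le (WithTop.coe_le_coe.mpr (le_top : (2 : ℕ∞) ≤ ⊤))).log (hne _ ?_)).neg
  rwa [OpenPartialHomeomorph.left_inv _ (mem_chart_source E x)]

/-- At a maximum of `φ - ψ`, the curvature of `φ` is at most that of `ψ`. -/
theorem LineMetric.curvature_le_of_isMax {φ ψ : LineMetric E L} {x : X}
    (h : ∀ y, φ.diff ψ y ≤ φ.diff ψ x) (u : E) :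
    (φ.curvature x u u).re ≤ (ψ.curvature x u u).re := by
  refine leviForm_self_re_le_of_isLocalMax (φ.contDiffAt_weight x) (ψ.contDiffAt_weight x) ?_ u
  have hx := FiberBundle.mem_baseSet_trivializationAt' (F := ℂ) (E := L) x
  have hc : Tendsto (chartAt E x).symm (𝓝 (chartAt E x x)) (𝓝 x) := by
    have := (chartAt E x).continuousAt_symm (mem_chart_target E x)
    rwa [ContinuousAt, OpenPartialHomeomorph.left_inv _ (mem_chart_source E x)] at this
  -- `diff` uses a frame that varies with the point, whereas the curvature at `x` uses the frame at
  -- `x`; on its base set the two agree.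
  filter_upwards [hc.eventually ((trivializationAt ℂ L x).open_baseSet.mem_nhds hx)] with z hz
  rw [OpenPartialHomeomorph.left_inv _ (mem_chart_source E x), ← φ.diff_eq ψ _ hz,
    ← φ.diff_eq ψ _ hx]
  exact h _

end LineMetric

/-! ### Monotonicity of the traced geodesic curvature at a maximum of `φ - ψ`. -/

section Comparison

open scoped ComplexOrder

variable {E F : Type*} [NormedAddCommGroup E] [NormedSpace ℂ E] [FiniteDimensional ℂ E]
  [NormedAddCommGroup F] [NormedSpace ℂ F]
  {X M : Type*} [TopologicalSpace X] [ChartedSpace E X] [TopologicalSpace M] [ChartedSpace F M]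
  {L : X → Type*} [∀ x, AddCommGroup (L x)] [∀ x, Module ℂ (L x)]
  [∀ x, TopologicalSpace (L x)] [TopologicalSpace (Bundle.TotalSpace ℂ L)] [FiberBundle ℂ L]

/-- `φ.curvature x` as a sesquilinear map. -/
def LineMetric.curvatureMap (φ : LineMetric E L) (x : X) : E →ₗ[ℂ] E →ₗ⋆[ℂ] ℂ :=
  leviMap (fun z => φ.weight (trivializationAt ℂ L x) ((chartAt E x).symm z)) (chartAt E x x)

theorem geodesicCurvature_eq_schur (π : X → M) (φ : LineMetric E L) (x : X) (u w : E) :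
    geodesicCurvature (F := F) π φ x u w =
      schur (φ.curvatureMap x)
        (fun i => (Module.finBasis ℂ (vertical (E := E) (F := F) π x) i : E)) u w := by
  rw [schur_apply]
  rfl

theorem form_gram_posDef [IsManifold 𝓘(ℂ, F) ω M] (g : KahlerMetric F M) (y : M) {ι : Type*}
    [Fintype ι] {v : ι → F} (hv : LinearIndependent ℂ v) :
    (Matrix.of fun i j => g.form y (v i) (v j)).PosDef :=
  gram_posDef (B := g.form y) (g.hermitian y) hv fun u _ hu => g.pos y u hu

theorem trGeodesicCurvature_eq_trace [FiniteDimensional ℂ F] [IsManifold 𝓘(ℂ, F) ω M] (π : X → M)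
    (g : KahlerMetric F M) (φ : LineMetric E L) (x : X) :
    trGeodesicCurvature π g φ x =
      ((Matrix.of fun α β => g.form (π x) (Module.finBasis ℂ F α) (Module.finBasis ℂ F β))⁻¹ *
        gram (schur (φ.curvatureMap x)
            fun i => (Module.finBasis ℂ (vertical (E := E) (F := F) π x) i : E))
          fun α => Function.invFun (differential (E := E) (F := F) π x)
            (Module.finBasis ℂ F α)).trace.re := by
  simp only [trGeodesicCurvature, geodesicCurvature_eq_schur, Matrix.trace, Matrix.diag_apply,
    Matrix.mul_apply, gram, Matrix.of_apply]
  rw [Finset.sum_comm]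

theorem trGeodesicCurvature_le_of_isMax [FiniteDimensional ℂ F] [VectorBundle ℂ ℂ L]
    [IsManifold 𝓘(ℂ, F) ω M] {π : X → M}
    (g : KahlerMetric F M) {φ ψ : LineMetric E L} (hφ : φ ∈ FPlus (F := F) π)
    (hψ : ψ ∈ FPlus (F := F) π) {x : X} (h : ∀ y, φ.diff ψ y ≤ φ.diff ψ x) :
    trGeodesicCurvature π g φ x ≤ trGeodesicCurvature π g ψ x := by
  set b := Module.finBasis ℂ (vertical (E := E) (F := F) π x)
  have hv : LinearIndependent ℂ fun i => (b i : E) :=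
    b.linearIndependent.map' (Submodule.subtype _) (Submodule.ker_subtype _)
  have hspan : ∀ u ∈ Submodule.span ℂ (Set.range fun i => (b i : E)),
      u ∈ vertical (E := E) (F := F) π x := by
    change Submodule.span ℂ _ ≤ _
    rw [Submodule.span_le]
    rintro _ ⟨i, rfl⟩
    exact (b i).2
  rw [trGeodesicCurvature_eq_trace, trGeodesicCurvature_eq_trace]
  -- The vertical basis, the lifts and the matrix of `g` depend on `π` and `g` alone, so both
  -- metrics are tested on the same data and independence of the lifts is not needed.
  exact trace_inv_mul_schur_mono (B := φ.curvatureMap x) (C := ψ.curvatureMap x)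
    (leviForm_hermitian (φ.contDiffAt_weight x)) (leviForm_hermitian (ψ.contDiffAt_weight x)) hv
    (fun u hu => hφ x u (hspan u hu)) (fun u hu => hψ x u (hspan u hu))
    (LineMetric.curvature_le_of_isMax h)
    (form_gram_posDef g (π x) (Module.finBasis ℂ F).linearIndependent)
    (fun α => Function.invFun (differential (E := E) (F := F) π x) (Module.finBasis ℂ F α))

end Comparison

/-! ### The half-open time interval. -/

section TimeInterval

open Set

theorem Icc_subset_timeInterval {T : EReal} {a : ℝ} (ha : a ∈ timeInterval T) :
    Icc 0 a ⊆ timeInterval T := fun _ ht =>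
  ⟨ht.1, (EReal.coe_le_coe_iff.mpr ht.2).trans_lt ha.2⟩

theorem exists_gt_mem_timeInterval {T : EReal} {a : ℝ} (ha : a ∈ timeInterval T) :
    ∃ b ∈ timeInterval T, a < b := by
  obtain ⟨b, h1, h2⟩ := EReal.lt_iff_exists_real_btwn.mp ha.2
  have hab : a < b := EReal.coe_lt_coe_iff.mp h1
  exact ⟨b, ⟨ha.1.trans hab.le, h2⟩, hab⟩

theorem convex_timeInterval (T : EReal) : Convex ℝ (timeInterval T) := by
  refine Set.OrdConnected.convex ⟨fun a ha b hb t ht => ?_⟩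
  exact Icc_subset_timeInterval hb ⟨ha.1.trans ht.1, ht.2⟩

end TimeInterval

/-! ### Comparison along the flow, a priori bounds and the bound on the initial speed. -/

section Evolution

open Set Filter Topology

variable {E F : Type*} [NormedAddCommGroup E] [NormedSpace ℂ E]
  [NormedAddCommGroup F] [NormedSpace ℂ F]
  {X M : Type*} [TopologicalSpace X] [ChartedSpace E X] [TopologicalSpace M] [ChartedSpace F M]
  {L : X → Type*} [∀ x, AddCommGroup (L x)] [∀ x, Module ℂ (L x)]
  [∀ x, TopologicalSpace (L x)] [TopologicalSpace (Bundle.TotalSpace ℂ L)] [FiberBundle ℂ L]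

/-- A family of metrics in `F⁺(L)` on the time interval `[0, a]` which is continuous and has the
time derivative `d`. -/
structure IsEvolution (π : X → M) (φ : ℝ → LineMetric E L) (d : X → ℝ → ℝ) (a : ℝ) : Prop where
  continuousOn : ∀ (e : Bundle.Trivialization ℂ
      (Bundle.TotalSpace.proj : Bundle.TotalSpace ℂ L → X)) [MemTrivializationAtlas e],
    ContinuousOn (fun p : X × ℝ => (φ p.2).weight e p.1) (e.baseSet ×ˢ Icc 0 a)
  mem_FPlus : ∀ t ∈ Icc 0 a, φ t ∈ FPlus (F := F) π
  hasDeriv : ∀ x, ∀ t ∈ Icc 0 a, HasDerivWithinAt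
    (fun s => (φ s).weight (trivializationAt ℂ L x) x) (d x t) (Icc 0 a) t

theorem LineMetric.diff_comm (φ ψ : LineMetric E L) (x : X) : φ.diff ψ x = -ψ.diff φ x := by
  simp [LineMetric.diff]

/-- The stationary family serves as a barrier, although it need not solve the flow. -/
theorem IsEvolution.const [VectorBundle ℂ ℂ L] {π : X → M} {φ₀ : LineMetric E L}
    (h : φ₀ ∈ FPlus (F := F) π) (a : ℝ) : IsEvolution (F := F) π (fun _ => φ₀) 0 a where
  continuousOn e _ := by
    have : ContinuousOn (φ₀.weight e) e.baseSet :=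
      ((φ₀.smooth e).continuousOn.log fun x hx => (φ₀.pos _ _ (frame_ne_zero e hx)).ne').neg
    exact this.comp continuous_fst.continuousOn fun p hp => hp.1
  mem_FPlus _ _ := h
  hasDeriv _ _ _ := hasDerivWithinAt_const ..

theorem IsEvolution.continuousOn_diff [VectorBundle ℂ ℂ L] {π : X → M}
    {φ ψ : ℝ → LineMetric E L} {d d' : X → ℝ → ℝ} {a : ℝ}
    (hφ : IsEvolution (F := F) π φ d a) (hψ : IsEvolution (F := F) π ψ d' a) :
    ContinuousOn (fun p : X × ℝ => (φ p.2).diff (ψ p.2) p.1) (univ ×ˢ Icc 0 a) := by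
  rintro ⟨x, t⟩ ⟨-, ht⟩
  have hx := FiberBundle.mem_baseSet_trivializationAt' (F := ℂ) (E := L) x
  have hnhds : (trivializationAt ℂ L x).baseSet ∈ 𝓝 x :=
    (trivializationAt ℂ L x).open_baseSet.mem_nhds hx
  have h1 := ((hφ.continuousOn (trivializationAt ℂ L x)).sub
    (hψ.continuousOn (trivializationAt ℂ L x))) (x, t) ⟨hx, ht⟩
  have h2 : (trivializationAt ℂ L x).baseSet ×ˢ Icc 0 a ∈ 𝓝[univ ×ˢ Icc 0 a] (x, t) := by
    rw [nhdsWithin_prod_eq, nhdsWithin_univ]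
    exact prod_mem_prod hnhds self_mem_nhdsWithin
  refine (h1.mono_of_mem_nhdsWithin h2).congr_of_eventuallyEq ?_ ?_
  · filter_upwards [h2] with p hp using LineMetric.diff_eq _ _ _ hp.1
  · exact LineMetric.diff_eq _ _ _ hx

variable [FiniteDimensional ℂ E] [FiniteDimensional ℂ F] [IsManifold 𝓘(ℂ, F) ω M]
  {π : X → M} {g : KahlerMetric F M} {lam : ℝ}

/-- The comparison principle for the trace of the geodesic curvature. -/
theorem IsEvolution.diff_le [CompactSpace X] [VectorBundle ℂ ℂ L] (g : KahlerMetric F M)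
    {φ ψ : ℝ → LineMetric E L} {d d' : X → ℝ → ℝ} {a m K : ℝ}
    (hφ : IsEvolution (F := F) π φ d a) (hψ : IsEvolution (F := F) π ψ d' a)
    (hinit : ∀ x, (φ 0).diff (ψ 0) x ≤ m)
    (hK : ∀ t ∈ Icc 0 a, ∀ x,
      trGeodesicCurvature π g (φ t) x ≤ trGeodesicCurvature π g (ψ t) x → d x t - d' x t ≤ K)
    {t : ℝ} (ht : t ∈ Icc 0 a) (x : X) : (φ t).diff (ψ t) x ≤ m + K * t :=
  le_add_mul_of_deriv_le_at_max (f := fun x t => (φ t).diff (ψ t) x)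
    (hφ.continuousOn_diff hψ)
    (fun x t ht => (hφ.hasDeriv x t ht).fun_sub (hψ.hasDeriv x t ht)) hinit
    (fun t ht x h => hK t ht x
      (trGeodesicCurvature_le_of_isMax g (hφ.mem_FPlus t ht) (hψ.mem_FPlus t ht) h)) x t ht

/-- The equation is autonomous, so a time translate evolves by the same law from another initial
metric. -/
theorem IsFlowSolution.isEvolution_shift {φ₀ : LineMetric E L} {T : EReal}
    {φ : ℝ → LineMetric E L} (hφ : IsFlowSolution π g lam φ₀ T φ) {a h : ℝ} (hh : 0 ≤ h)
    (ha : a + h ∈ timeInterval T) :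
    IsEvolution (F := F) π (fun s => φ (s + h))
      (fun x t => trGeodesicCurvature π g (φ (t + h)) x - lam) a := by
  have hmaps : MapsTo (fun s => s + h) (Icc 0 a) (timeInterval T) := fun t ht =>
    Icc_subset_timeInterval ha ⟨add_nonneg ht.1 hh, add_le_add_left ht.2 h⟩
  refine ⟨fun e _ => ?_, fun t ht => hφ.mem_FPlus _ (hmaps ht), fun x t ht => ?_⟩
  · exact (hφ.smooth e).continuousOn.comp (f := fun p : X × ℝ => (p.1, p.2 + h))
      (by fun_prop) fun p hp => ⟨hp.1, hmaps hp.2⟩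
  · have := HasDerivWithinAt.comp t (hφ.equation _ (hmaps ht) x)
      ((hasDerivWithinAt_id t (Icc 0 a)).add_const h) hmaps
    simpa [Function.comp_def] using this

theorem IsFlowSolution.isEvolution {φ₀ : LineMetric E L} {T : EReal}
    {φ : ℝ → LineMetric E L} (hφ : IsFlowSolution π g lam φ₀ T φ) {a : ℝ}
    (ha : a ∈ timeInterval T) :
    IsEvolution (F := F) π φ (fun x t => trGeodesicCurvature π g (φ t) x - lam) a := by
  simpa using hφ.isEvolution_shift le_rfl (by simpa using ha)

theorem IsFlowSolution.diff_le_zero [CompactSpace X] [VectorBundle ℂ ℂ L] {φ₀ : LineMetric E L}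
    {T₁ T₂ : EReal} {φ ψ : ℝ → LineMetric E L} (hφ : IsFlowSolution π g lam φ₀ T₁ φ)
    (hψ : IsFlowSolution π g lam φ₀ T₂ ψ) {t : ℝ} (ht₁ : t ∈ timeInterval T₁)
    (ht₂ : t ∈ timeInterval T₂) (x : X) : (φ t).diff (ψ t) x ≤ 0 := by
  simpa using (hφ.isEvolution ht₁).diff_le g (hψ.isEvolution ht₂) (m := 0) (K := 0)
    (fun x => by simp [hφ.initial, hψ.initial, LineMetric.diff])
    (fun t _ x h => by linarith) ⟨ht₁.1, le_rfl⟩ x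

/-- At a maximum of `φ(t) - φ₀` the speed of `φ` is at most `tr_ω c(φ₀) - lam ≤ K`; at a minimum it
is at least `-K`. -/
theorem IsFlowSolution.abs_diff_initial_le [CompactSpace X] [VectorBundle ℂ ℂ L]
    {φ₀ : LineMetric E L} (hφ₀ : φ₀ ∈ FPlus (F := F) π) {K : ℝ}
    (hK : ∀ x, |trGeodesicCurvature π g φ₀ x - lam| ≤ K) {T : EReal} {φ : ℝ → LineMetric E L}
    (hφ : IsFlowSolution π g lam φ₀ T φ) {t : ℝ} (ht : t ∈ timeInterval T) (x : X) :
    |(φ t).diff φ₀ x| ≤ K * t := by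
  have hinit : ∀ x, (φ 0).diff φ₀ x ≤ 0 ∧ φ₀.diff (φ 0) x ≤ 0 := fun x => by
    simp [hφ.initial, LineMetric.diff]
  have h1 := (hφ.isEvolution ht).diff_le g (IsEvolution.const hφ₀ t) (m := 0) (K := K)
    (fun x => (hinit x).1)
    (fun s _ x h => by simp only [Pi.zero_apply]; linarith [(abs_le.mp (hK x)).2])
    ⟨ht.1, le_rfl⟩ x
  have h2 := (IsEvolution.const hφ₀ t).diff_le g (hφ.isEvolution ht) (m := 0) (K := K)
    (fun x => (hinit x).2)
    (fun s _ x h => by simp only [Pi.zero_apply]; linarith [(abs_le.mp (hK x)).1])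
    ⟨ht.1, le_rfl⟩ x
  rw [LineMetric.diff_comm] at h2
  rw [abs_le]
  constructor <;> linarith

/-- The speed of the flow is bounded by its initial speed. -/
theorem IsFlowSolution.abs_trGeodesicCurvature_sub_le [CompactSpace X] [VectorBundle ℂ ℂ L]
    {φ₀ : LineMetric E L} (hφ₀ : φ₀ ∈ FPlus (F := F) π) {K : ℝ}
    (hK : ∀ x, |trGeodesicCurvature π g φ₀ x - lam| ≤ K) {T : EReal} {φ : ℝ → LineMetric E L}
    (hφ : IsFlowSolution π g lam φ₀ T φ) {t : ℝ} (ht : t ∈ timeInterval T) (x : X) :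
    |trGeodesicCurvature π g (φ t) x - lam| ≤ K := by
  -- Room to the right of `t`, so that the speed at `t` is a limit of forward difference quotients,
  -- also for `t = 0`.
  obtain ⟨b, hb, htb⟩ := exists_gt_mem_timeInterval ht
  have hsub : Icc t b ⊆ timeInterval T := fun s hs =>
    Icc_subset_timeInterval hb ⟨ht.1.trans hs.1, hs.2⟩
  refine abs_le_of_hasDerivWithinAt_of_lipschitz htb hsub (hφ.equation t ht x) fun s hs => ?_
  have hst : 0 ≤ s - t := sub_nonneg.mpr hs.1
  have hinit : ∀ x, |(φ (0 + (s - t))).diff (φ 0) x| ≤ K * (s - t) := fun x => by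
    rw [hφ.initial, zero_add]
    exact hφ.abs_diff_initial_le hφ₀ hK
      (Icc_subset_timeInterval (hsub hs) ⟨hst, by linarith [ht.1]⟩) x
  have e1 := hφ.isEvolution_shift (a := t) hst (by simpa using hsub hs)
  -- Both families obey the same equation, so their gap does not grow (rate `0`) and stays below its
  -- initial size `K (s - t)`.
  have h1 := e1.diff_le g (hφ.isEvolution ht) (m := K * (s - t)) (K := 0)
    (fun x => (abs_le.mp (hinit x)).2) (fun r _ x h => by linarith) ⟨ht.1, le_rfl⟩ x
  have h2 := (hφ.isEvolution ht).diff_le g e1 (m := K * (s - t)) (K := 0)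
    (fun x => by rw [LineMetric.diff_comm]; linarith [(abs_le.mp (hinit x)).1])
    (fun r _ x h => by linarith) ⟨ht.1, le_rfl⟩ x
  rw [LineMetric.diff_comm] at h2
  rw [add_sub_cancel] at h1 h2
  change |(φ s).diff (φ t) x| ≤ _
  rw [abs_le]
  constructor <;> linarith

/-- Near any point, a solution is uniformly Lipschitz in time at the initial time. -/
theorem IsFlowSolution.exists_eventually_abs_le [VectorBundle ℂ ℂ L] {φ₀ : LineMetric E L}
    {T : EReal} {φ : ℝ → LineMetric E L} (hφ : IsFlowSolution π g lam φ₀ T φ)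
    (h0 : 0 ∈ timeInterval T) (x₀ : X) :
    ∃ K : ℝ, ∀ᶠ x in 𝓝 x₀, |trGeodesicCurvature π g φ₀ x - lam| ≤ K := by
  set e := trivializationAt ℂ L x₀
  have hx₀ : x₀ ∈ e.baseSet := FiberBundle.mem_baseSet_trivializationAt' (F := ℂ) (E := L) x₀
  have h1 : ContDiffWithinAt ℝ ∞
      (fun q : E × ℝ => (φ q.2).weight e ((chartAt E x₀).symm q.1))
      (((chartAt E x₀).symm ⁻¹' e.baseSet) ×ˢ timeInterval T) (chartAt E x₀ x₀, 0) := by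
    have := (contMDiffWithinAt_iff.mp (hφ.smooth e (x₀, 0) ⟨hx₀, h0⟩)).2
    rw [(𝓘(ℝ, E).prod 𝓘(ℝ, ℝ)).range_eq_univ, inter_univ] at this
    exact this
  have hsymm := (chartAt E x₀).continuousAt_symm (mem_chart_target E x₀)
  rw [ContinuousAt, OpenPartialHomeomorph.left_inv _ (mem_chart_source E x₀)] at hsymm
  have h2 : ContDiffWithinAt ℝ 1
      (fun q : E × ℝ => (φ q.2).weight e ((chartAt E x₀).symm q.1))
      (univ ×ˢ timeInterval T) (chartAt E x₀ x₀, 0) := by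
    refine (h1.of_le (WithTop.coe_le_coe.mpr (le_top : (1 : ℕ∞) ≤ ⊤))).mono_of_mem_nhdsWithin ?_
    rw [nhdsWithin_prod_eq, nhdsWithin_univ]
    exact prod_mem_prod (hsymm (e.open_baseSet.mem_nhds hx₀)) self_mem_nhdsWithin
  -- `C¹` on a convex set gives one Lipschitz constant near `(x₀, 0)`, uniform in the space
  -- variable.
  obtain ⟨K, u, hu, hK⟩ := h2.exists_lipschitzOnWith
    (convex_univ.prod (convex_timeInterval T))
  rw [nhdsWithin_prod_eq, nhdsWithin_univ, mem_prod_iff] at hu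
  obtain ⟨V, hV, W, hW, hVW⟩ := hu
  obtain ⟨ε, hε, hεW⟩ := Metric.mem_nhdsWithin_iff.mp hW
  obtain ⟨b, hb, hb0⟩ := exists_gt_mem_timeInterval h0
  refine ⟨K, ?_⟩
  filter_upwards [((chartAt E x₀).continuousAt (mem_chart_source E x₀)) hV,
    e.open_baseSet.mem_nhds hx₀, chart_source_mem_nhds E x₀] with x hxV hxe hxs
  have hmem : ∀ t ∈ Icc 0 (min b (ε / 2)), t ∈ timeInterval T ∧ t ∈ W := fun t ht => by
    have htT := Icc_subset_timeInterval hb ⟨ht.1, ht.2.trans (min_le_left _ _)⟩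
    refine ⟨htT, hεW ⟨?_, htT⟩⟩
    have := ht.2.trans (min_le_right _ _)
    rw [Metric.mem_ball, Real.dist_eq, sub_zero, abs_of_nonneg ht.1]
    linarith
  have hpos : 0 < min b (ε / 2) := lt_min hb0 (half_pos hε)
  have heq := hφ.equation 0 h0 x
  rw [hφ.initial] at heq
  refine abs_le_of_hasDerivWithinAt_of_lipschitz hpos (fun t ht => (hmem t ht).1) heq
    fun t ht => ?_
  -- The two points share their space coordinate, so their distance is `t`.
  have h3 := hK.dist_le_mul (chartAt E x₀ x, t) (hVW ⟨hxV, (hmem t ht).2⟩)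
    (chartAt E x₀ x, 0) (hVW ⟨hxV, (hmem 0 ⟨le_rfl, hpos.le⟩).2⟩)
  simp only [OpenPartialHomeomorph.left_inv _ hxs] at h3
  rw [dist_prod_same_left, Real.dist_eq, Real.dist_eq, ← LineMetric.diff_eq _ _ e hxe, sub_zero,
    abs_of_nonneg ht.1] at h3
  rwa [sub_zero]

theorem IsFlowSolution.exists_abs_le [CompactSpace X] [VectorBundle ℂ ℂ L] {φ₀ : LineMetric E L}
    {T : EReal} {φ : ℝ → LineMetric E L} (hφ : IsFlowSolution π g lam φ₀ T φ)
    (h0 : 0 ∈ timeInterval T) :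
    ∃ K : ℝ, 0 ≤ K ∧ ∀ x, |trGeodesicCurvature π g φ₀ x - lam| ≤ K := by
  choose K hK using hφ.exists_eventually_abs_le h0
  obtain ⟨s, hs⟩ := CompactSpace.elim_nhds_subcover _ hK
  refine ⟨∑ y ∈ s, |K y|, Finset.sum_nonneg fun _ _ => abs_nonneg _, fun x => ?_⟩
  obtain ⟨y, hy, hxy⟩ := mem_iUnion₂.mp (hs.ge (mem_univ x))
  exact (hxy.trans (le_abs_self _)).trans
    (Finset.single_le_sum (f := fun y => |K y|) (fun _ _ => abs_nonneg _) hy)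

end Evolution

end GeodesicFlow

end

/-! ### The main theorem. -/

theorem mainTheorem9
    {E F : Type*} [NormedAddCommGroup E] [NormedSpace ℂ E] [FiniteDimensional ℂ E]
    [NormedAddCommGroup F] [NormedSpace ℂ F] [FiniteDimensional ℂ F]
    {X M : Type*}
    [TopologicalSpace X] [T2Space X] [ChartedSpace E X] [IsManifold 𝓘(ℂ, E) ω X]
    [TopologicalSpace M] [T2Space M] [ChartedSpace F M] [IsManifold 𝓘(ℂ, F) ω M]
    [CompactSpace M]
    (π : X → M) (hπ : GeodesicFlow.IsHolomorphicFibration E F π)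
    (L : X → Type*) [∀ x, AddCommGroup (L x)] [∀ x, Module ℂ (L x)]
    [∀ x, TopologicalSpace (L x)] [TopologicalSpace (Bundle.TotalSpace ℂ L)]
    [FiberBundle ℂ L] [VectorBundle ℂ ℂ L] [ContMDiffVectorBundle ω ℂ L 𝓘(ℂ, E)]
    (g : GeodesicFlow.KahlerMetric F M) (lam : ℝ)
    (φ₀ : GeodesicFlow.LineMetric E L) (hφ₀ : φ₀ ∈ GeodesicFlow.FPlus (F := F) π) :
    (∀ (T₁ T₂ : EReal) (φ ψ : ℝ → GeodesicFlow.LineMetric E L),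
      GeodesicFlow.IsFlowSolution π g lam φ₀ T₁ φ →
      GeodesicFlow.IsFlowSolution π g lam φ₀ T₂ ψ →
      ∀ t ∈ GeodesicFlow.timeInterval T₁ ∩ GeodesicFlow.timeInterval T₂, φ t = ψ t) ∧
    (∃ C : ℝ, 0 < C ∧ ∀ (T : EReal) (φ : ℝ → GeodesicFlow.LineMetric E L),
      GeodesicFlow.IsFlowSolution π g lam φ₀ T φ →
      ∀ t ∈ GeodesicFlow.timeInterval T, ∀ x : X,
        |GeodesicFlow.trGeodesicCurvature π g (φ t) x| < C ∧
        |(φ t).diff φ₀ x| ≤ C * t) := by 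
  have : CompactSpace X := ⟨by simpa using hπ.proper.isCompact_preimage isCompact_univ⟩
  refine ⟨fun T₁ T₂ φ ψ hφ hψ t ht => ?_, ?_⟩
  · refine GeodesicFlow.LineMetric.eq_of_diff_eq_zero fun x =>
      le_antisymm (hφ.diff_le_zero hψ ht.1 ht.2 x) ?_
    rw [GeodesicFlow.LineMetric.diff_comm, Left.nonneg_neg_iff]
    exact hψ.diff_le_zero hφ ht.2 ht.1 x
  -- One solution on a nonempty interval suffices to bound the initial speed, and that bound depends
  -- only on `φ₀` and the fixed data; if there is none, the claim is vacuous.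
  · by_cases h : ∃ T φ, GeodesicFlow.IsFlowSolution π g lam φ₀ T φ ∧
        0 ∈ GeodesicFlow.timeInterval T
    · obtain ⟨T₀, φ', hφ', h0⟩ := h
      obtain ⟨K, hK0, hK⟩ := hφ'.exists_abs_le h0
      -- `|lam|` passes from the speed to the trace, and `1` makes the inequality strict.
      refine ⟨K + |lam| + 1, by positivity, fun T φ hφ t ht x => ⟨?_, ?_⟩⟩
      · have h1 := hφ.abs_trGeodesicCurvature_sub_le hφ₀ hK ht x
        have h2 := abs_sub_abs_le_abs_sub (GeodesicFlow.trGeodesicCurvature π g (φ t) x) lam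
        linarith
      · refine (hφ.abs_diff_initial_le hφ₀ hK ht x).trans
          (mul_le_mul_of_nonneg_right ?_ ht.1)
        linarith [abs_nonneg lam]
    · refine ⟨1, one_pos, fun T φ hφ t ht => absurd ⟨T, φ, hφ, ?_⟩ h⟩
      exact GeodesicFlow.Icc_subset_timeInterval ht ⟨le_rfl, ht.1⟩
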